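/- A group is amenable if it admits a left-invariant mean. The class of elementary amenable groups is the smallest class of groups, closed under isomorphism, that contains all finite groups and all solvable groups and is closed under taking subgroups, quotients, extensions and direct limits. For a class of groups $\mathcal{C}$, a group $G$ is residually $\mathcal{C}$ if for every $g \in G$ with $g \neq e$ there are a group $C \in \mathcal{C}$ and a surjective homomorphism $\varphi \colon G \to C$ with $\varphi(g) \neq e$. Let $(G_i)_{i \in I}$ be an arbitrary (possibly infinite) family of groups. If every $G_i$ is residually amenable, then the free product $\ast_{i \in I} G_i$ is residually amenable. If every $G_i$ is residually elementary amenable, then $\ast_{i \in I} G_i$ is residually elementary amenable. -/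

import Mathlib

universe u

open scoped ENNReal

/-- A (discrete) group `G` is amenable if there is a left-invariant mean on `ℓ^∞(G)`: a linear
functional on the space of bounded real functions on `G` which is normalized, positive and
invariant under left translations. -/
def IsAmenable (G : Type u) [Group G] : Prop :=
  ∃ m : lp (fun _ : G ↦ ℝ) ∞ →ₗ[ℝ] ℝ,
    m 1 = 1 ∧
    (∀ f : lp (fun _ : G ↦ ℝ) ∞, (∀ x, 0 ≤ f x) → 0 ≤ m f) ∧
    (∀ (g : G) (f f' : lp (fun _ : G ↦ ℝ) ∞), (∀ x, f' x = f (g * x)) → m f' = m f)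

/-- Elementary amenable groups: the smallest class of groups (closed under isomorphism) that
contains the finite and the solvable groups and is closed under taking subgroups, quotients,
extensions and direct limits. -/
inductive IsElementaryAmenable : ∀ (G : Type u) [Group G], Prop
  | of_finite (G : Type u) [Group G] [Finite G] : IsElementaryAmenable G
  | of_isSolvable (G : Type u) [Group G] [Group.IsSolvable G] : IsElementaryAmenable G
  | of_mulEquiv {G H : Type u} [Group G] [Group H] (e : G ≃* H)
      (hG : IsElementaryAmenable G) : IsElementaryAmenable H
  | subgroup {G : Type u} [Group G] (H : Subgroup G)
      (hG : IsElementaryAmenable G) : IsElementaryAmenable H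
  | quotient {G : Type u} [Group G] (N : Subgroup G) [N.Normal]
      (hG : IsElementaryAmenable G) : IsElementaryAmenable (G ⧸ N)
  | extension {G : Type u} [Group G] (N : Subgroup G) [N.Normal]
      (hN : IsElementaryAmenable N) (hQ : IsElementaryAmenable (G ⧸ N)) : IsElementaryAmenable G
  | directLimit {ι : Type u} [Preorder ι] [IsDirectedOrder ι] [Nonempty ι]
      (G : ι → Type u) [∀ i, Group (G i)] (f : ∀ i j, i ≤ j → G i →* G j)
      [DirectedSystem G (fun i j h ↦ f i j h)]
      (hG : ∀ i, IsElementaryAmenable (G i)) : IsElementaryAmenable (DirectLimit G f)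

/-- Let `C` be a class of groups. A group `G` is residually `C` if for every non-trivial `g` in
`G` there are a group `H` in the class `C` and a surjective homomorphism `φ` from `G` to `H` such
that `φ g` is non-trivial. -/
def IsResidually (C : ∀ (G : Type u) [Group G], Prop) (G : Type u) [Group G] : Prop :=
  ∀ g : G, g ≠ 1 → ∃ (H : Type u) (_ : Group H) (φ : G →* H),
    C H ∧ Function.Surjective φ ∧ φ g ≠ 1

/-! Both cases use only that the class is closed under isomorphisms, subgroups and extensions and
contains the abelian groups. For a reduced word `l`, the free product is made to act on an abelian
group with a vector `v` and a functional `e` such that `e (u v)` vanishes for all words `u` shorter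
than `l`, but `e (l v) = 1`. For nonempty `l` this gives `e v = 0`, so `l` acts nontrivially.

The action is built letter by letter (`exists_action_detecting_word`). To append `x`, a quotient `H`
of its factor detecting `x` is chosen, and the module is enlarged by `H → ℤ` through a cocycle. The
subgroup acting trivially shrinks from `N` to the commutator subgroup of `N ⊓ D.ker`, whose quotient
stays in the class. -/

open Filter Topology

/-! ### Means on bounded functions and their limits. -/

section Mean

/-- Bounded real functions on `X`. -/
abbrev BoundedFun (X : Type u) := lp (fun _ : X ↦ ℝ) ∞

namespace BoundedFun

variable {X Y : Type u}

theorem abs_apply_le (f : BoundedFun X) (x : X) : |f x| ≤ ‖f‖ :=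
  lp.norm_apply_le_norm ENNReal.top_ne_zero f x

/-- The element of `BoundedFun X` given by a function with an explicit bound. -/
def ofBound (f : X → ℝ) (c : ℝ) (h : ∀ x, |f x| ≤ c) : BoundedFun X :=
  ⟨f, memℓp_infty_iff.2 ⟨c, by rintro _ ⟨x, rfl⟩; exact h x⟩⟩

@[simp] theorem ofBound_apply (f : X → ℝ) (c : ℝ) (h : ∀ x, |f x| ≤ c) (x : X) :
    ofBound f c h x = f x := rfl

/-- Composition with a map of the underlying sets. -/
noncomputable def pull (φ : X → Y) : BoundedFun Y →ₗ[ℝ] BoundedFun X where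
  toFun f := ofBound (fun x ↦ f (φ x)) ‖f‖ fun x ↦ abs_apply_le f (φ x)
  map_add' f g := by ext x; rfl
  map_smul' c f := by ext x; rfl

@[simp] theorem pull_apply (φ : X → Y) (f : BoundedFun Y) (x : X) : pull φ f x = f (φ x) := rfl

theorem pull_one (φ : X → Y) : pull φ (1 : BoundedFun Y) = 1 := by ext x; rfl

@[simp] theorem one_apply (x : X) : (1 : BoundedFun X) x = 1 := rfl

end BoundedFun

open BoundedFun

/-- Normalized positive linear functionals on bounded functions. -/
structure IsMean {X : Type u} (m : BoundedFun X →ₗ[ℝ] ℝ) : Prop where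
  map_one : m 1 = 1
  nonneg : ∀ f, (∀ x, 0 ≤ f x) → 0 ≤ m f

variable {X Y : Type u}

theorem IsMean.comp_pull {m : BoundedFun X →ₗ[ℝ] ℝ} (hm : IsMean m) (φ : X → Y) :
    IsMean (m ∘ₗ pull φ) where
  map_one := by rw [LinearMap.comp_apply, pull_one, hm.map_one]
  nonneg f hf := hm.nonneg _ fun x ↦ hf (φ x)

theorem IsMean.abs_le {m : BoundedFun X →ₗ[ℝ] ℝ} (hm : IsMean m) (f : BoundedFun X) :
    |m f| ≤ ‖f‖ := by
  have h1 := hm.nonneg (‖f‖ • 1 - f) fun x ↦ by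
    have := (_root_.abs_le.1 (abs_apply_le f x)).2
    change 0 ≤ ‖f‖ * 1 - f x
    linarith
  have h2 := hm.nonneg (‖f‖ • 1 + f) fun x ↦ by
    have := (_root_.abs_le.1 (abs_apply_le f x)).1
    change 0 ≤ ‖f‖ * 1 + f x
    linarith
  simp only [map_sub, map_add, map_smul, hm.map_one, smul_eq_mul, mul_one] at h1 h2
  exact _root_.abs_le.2 ⟨by linarith, by linarith⟩

/-- Take the limit along an ultrafilter finer than `l`; it exists because `m i f` stays in the
compact interval `[-‖f‖, ‖f‖]`. -/
theorem exists_isMean_eq_of_tendsto {ι : Type*} (l : Filter ι) [l.NeBot]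
    (m : ι → BoundedFun X →ₗ[ℝ] ℝ) (hm : ∀ i, IsMean (m i)) :
    ∃ m' : BoundedFun X →ₗ[ℝ] ℝ, IsMean m' ∧
      ∀ f f', Tendsto (fun i ↦ m i f - m i f') l (𝓝 0) → m' f = m' f' := by
  set U := Ultrafilter.of l
  have key (f : BoundedFun X) : ∃ c, Tendsto (fun i ↦ m i f) U (𝓝 c) := by
    obtain ⟨c, -, hc⟩ := (isCompact_Icc (a := -‖f‖) (b := ‖f‖)).ultrafilter_le_nhds
      (U.map fun i ↦ m i f)
      (by
        refine le_principal_iff.2 (Ultrafilter.mem_map.2 ?_)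
        exact Filter.univ_mem' fun i ↦ abs_le.1 ((hm i).abs_le f))
    exact ⟨c, hc⟩
  choose L hL using key
  refine ⟨⟨⟨L, fun f g ↦ ?_⟩, fun c f ↦ ?_⟩, ⟨?_, fun f hf ↦ ?_⟩, fun f f' h ↦ ?_⟩
  · exact tendsto_nhds_unique (hL _) (by simpa only [map_add] using (hL f).add (hL g))
  · exact tendsto_nhds_unique (hL _) (by simpa only [map_smul, RingHom.id_apply] using (hL f).const_smul c)
  · refine tendsto_nhds_unique (hL 1) ?_
    simp only [(hm _).map_one]
    exact tendsto_const_nhds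
  · exact ge_of_tendsto (hL f) (Filter.Eventually.of_forall fun i ↦ (hm i).nonneg f hf)
  · exact sub_eq_zero.1 (tendsto_nhds_unique ((hL f).sub (hL f')) (h.mono_left (Ultrafilter.of_le l)))

end Mean

/-! ### Closure properties of amenable groups. -/

section Amenable

open BoundedFun

variable {G H : Type u} [Group G] [Group H]

theorem isAmenable_iff : IsAmenable G ↔ ∃ m : BoundedFun G →ₗ[ℝ] ℝ, IsMean m ∧
    ∀ (g : G) (f : BoundedFun G), m (pull (g * ·) f) = m f := by
  constructor
  · rintro ⟨m, h1, h2, h3⟩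
    exact ⟨m, ⟨h1, h2⟩, fun g f ↦ h3 g f _ fun x ↦ rfl⟩
  · rintro ⟨m, hm, h⟩
    refine ⟨m, hm.map_one, hm.nonneg, fun g f f' hf ↦ ?_⟩
    rw [← h g f]
    congr 1
    ext x
    exact hf x

/-- A mean can be transported along a map that intertwines the translations. -/
theorem IsAmenable.of_map (hG : IsAmenable G) (φ : H →* G) (t : G → H)
    (ht : ∀ h x, t (φ h * x) = h * t x) : IsAmenable H := by
  obtain ⟨m, hm, h⟩ := isAmenable_iff.1 hG
  refine isAmenable_iff.2 ⟨m ∘ₗ pull t, hm.comp_pull t, fun g f ↦ ?_⟩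
  rw [LinearMap.comp_apply, LinearMap.comp_apply, ← h (φ g) (pull t f)]
  congr 1
  ext x
  simp [ht]

theorem IsAmenable.of_mulEquiv (e : G ≃* H) (hG : IsAmenable G) : IsAmenable H :=
  hG.of_map e.symm.toMonoidHom e fun h x ↦ by simp

theorem IsAmenable.subgroup (S : Subgroup G) (hG : IsAmenable G) : IsAmenable S := by
  -- Writing elements of `G` as `s * t` with `t` in a transversal, the projection to `s` is
  -- `S`-equivariant.
  obtain ⟨T, hT, -⟩ := S.exists_isComplement_right 1
  refine hG.of_map S.subtype (fun x ↦ (hT.equiv x).1) fun h x ↦ ?_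
  exact congrArg Prod.fst (hT.equiv_mul_left h x)

/-- Average over each coset of `N` first; the result depends only on the coset, by invariance of the
mean on `N`, and is then averaged over the quotient. -/
theorem IsAmenable.extension (N : Subgroup G) [N.Normal] (hN : IsAmenable N)
    (hQ : IsAmenable (G ⧸ N)) : IsAmenable G := by
  obtain ⟨m, hm, hmi⟩ := isAmenable_iff.1 hN
  obtain ⟨q, hq, hqi⟩ := isAmenable_iff.1 hQ
  set A : BoundedFun G → G → ℝ := fun f g ↦ m (pull (fun n : N ↦ g * n) f) with hA
  have bound (f : BoundedFun G) (g : G) : |A f g| ≤ ‖f‖ := by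
    refine (hm.abs_le _).trans ?_
    exact lp.norm_le_of_forall_le (norm_nonneg f) fun n ↦ abs_apply_le f _
  have coset (f : BoundedFun G) (a b : G) (h : (a : G ⧸ N) = b) : A f a = A f b := by
    have h' : a⁻¹ * b ∈ N := QuotientGroup.eq.1 h
    simp only [hA]
    rw [← hmi ⟨a⁻¹ * b, h'⟩]
    congr 1
    ext n
    simp [mul_assoc]
  let B : BoundedFun G →ₗ[ℝ] BoundedFun (G ⧸ N) :=
    { toFun := fun f ↦ ofBound (fun x ↦ A f x.out) ‖f‖ fun x ↦ bound f _
      map_add' := fun f g ↦ by ext x; simp [hA]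
      map_smul' := fun c f ↦ by ext x; simp [hA] }
  have B_apply (f : BoundedFun G) (x : G ⧸ N) : B f x = A f x.out := rfl
  refine isAmenable_iff.2 ⟨q ∘ₗ B, ⟨?_, fun f hf ↦ ?_⟩, fun g f ↦ ?_⟩
  · have : B 1 = 1 := by
      ext x
      rw [B_apply, one_apply]
      simp only [hA, pull_one, hm.map_one]
    rw [LinearMap.comp_apply, this, hq.map_one]
  · exact hq.nonneg _ fun x ↦ hm.nonneg _ fun n ↦ hf _
  · rw [LinearMap.comp_apply, LinearMap.comp_apply, ← hqi (g : G ⧸ N) (B f)]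
    congr 1
    ext x
    rw [pull_apply, B_apply, B_apply, coset f (((g : G ⧸ N) * x).out) (g * x.out) (by simp)]
    simp only [hA]
    congr 1
    ext n
    simp [mul_assoc]

/-- A limit of Cesàro averages over the powers of `g`: the defect of invariance telescopes, and
commutativity preserves any invariance already present. -/
theorem IsMean.exists_invariant_of_comm {G : Type u} [CommGroup G] {m : BoundedFun G →ₗ[ℝ] ℝ}
    (hm : IsMean m) (g : G) : ∃ m' : BoundedFun G →ₗ[ℝ] ℝ, IsMean m' ∧
      (∀ f, m' (pull (g * ·) f) = m' f) ∧
      ∀ h : G, (∀ f, m (pull (h * ·) f) = m f) → ∀ f, m' (pull (h * ·) f) = m' f := by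
  let a : ℕ → BoundedFun G →ₗ[ℝ] ℝ := fun n ↦
    (n + 1 : ℝ)⁻¹ • ∑ k ∈ Finset.range (n + 1), m ∘ₗ pull (g ^ k * ·)
  have a_apply (n : ℕ) (f : BoundedFun G) :
      a n f = (n + 1 : ℝ)⁻¹ * ∑ k ∈ Finset.range (n + 1), m (pull (g ^ k * ·) f) := by
    simp [a]
  have ha (n : ℕ) : IsMean (a n) := by
    refine ⟨?_, fun f hf ↦ ?_⟩
    · rw [a_apply]
      simp only [pull_one, hm.map_one, Finset.sum_const, Finset.card_range, nsmul_eq_mul]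
      push_cast
      field_simp
    · rw [a_apply]
      exact mul_nonneg (by positivity) (Finset.sum_nonneg fun k _ ↦ hm.nonneg _ fun x ↦ hf _)
  obtain ⟨m', hm', h⟩ := exists_isMean_eq_of_tendsto atTop a ha
  refine ⟨m', hm', fun f ↦ h _ _ ?_, fun x hx f ↦ h _ _ ?_⟩
  · have tele (n : ℕ) : a n (pull (g * ·) f) - a n f =
        (n + 1 : ℝ)⁻¹ * (m (pull (g ^ (n + 1) * ·) f) - m (pull (g ^ 0 * ·) f)) := by
      rw [a_apply, a_apply, ← mul_sub,
        ← Finset.sum_range_sub (fun k ↦ m (pull (g ^ k * ·) f)), ← Finset.sum_sub_distrib]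
      congr 1
      refine Finset.sum_congr rfl fun k _ ↦ ?_
      congr 2
      ext y
      simp only [pull_apply]
      rw [pow_succ', mul_assoc]
    have lim : Tendsto (fun n : ℕ ↦ (n + 1 : ℝ)⁻¹ * (2 * ‖f‖)) atTop (𝓝 0) := by
      have := (tendsto_one_div_add_atTop_nhds_zero_nat (𝕜 := ℝ)).mul_const (2 * ‖f‖)
      simpa using this
    refine squeeze_zero_norm (fun n ↦ ?_) lim
    rw [tele, norm_mul, Real.norm_of_nonneg (by positivity : (0 : ℝ) ≤ (n + 1 : ℝ)⁻¹)]
    refine mul_le_mul_of_nonneg_left ?_ (by positivity)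
    have b (k : ℕ) : |m (pull (g ^ k * ·) f)| ≤ ‖f‖ := (hm.comp_pull (g ^ k * ·)).abs_le f
    calc _ ≤ |m (pull (g ^ (n + 1) * ·) f)| + |m (pull (g ^ 0 * ·) f)| := abs_sub _ _
      _ ≤ 2 * ‖f‖ := by linarith [b (n + 1), b 0]
  · have (n : ℕ) : a n (pull (x * ·) f) - a n f = 0 := by
      rw [a_apply, a_apply, sub_eq_zero]
      congr 1
      refine Finset.sum_congr rfl fun k _ ↦ ?_
      rw [← hx (pull (g ^ k * ·) f)]
      congr 1
      ext y
      simp only [pull_apply]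
      rw [mul_left_comm]
    simp only [this]
    exact tendsto_const_nhds

theorem isAmenable_of_commGroup (G : Type u) [CommGroup G] : IsAmenable G := by
  have fin (s : Finset G) : ∃ m : BoundedFun G →ₗ[ℝ] ℝ, IsMean m ∧
      ∀ g ∈ s, ∀ f, m (pull (g * ·) f) = m f := by
    classical
    induction s using Finset.induction_on with
    | empty =>
      refine ⟨⟨⟨fun f ↦ f 1, fun f g ↦ rfl⟩, fun c f ↦ rfl⟩, ⟨rfl, fun f hf ↦ hf 1⟩, by simp⟩
    | insert g s _ ih =>
      obtain ⟨m, hm, h⟩ := ih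
      obtain ⟨m', hm', h1, h2⟩ := hm.exists_invariant_of_comm g
      refine ⟨m', hm', fun x hx ↦ ?_⟩
      rcases Finset.mem_insert.1 hx with rfl | hx
      · exact h1
      · exact h2 x (h x hx)
  -- Pass to the limit along the directed set of finite subsets.
  choose m hm h using fin
  obtain ⟨m', hm', h'⟩ := exists_isMean_eq_of_tendsto atTop m hm
  refine isAmenable_iff.2 ⟨m', hm', fun g f ↦ h' _ _ ?_⟩
  refine tendsto_const_nhds.congr' ?_
  filter_upwards [eventually_ge_atTop {g}] with s hs
  rw [h s g (hs (Finset.mem_singleton_self g)), sub_self]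

end Amenable

/-! ### Extension-closed classes. -/

/-- Classes of groups closed under isomorphisms, subgroups and extensions that contain all
commutative groups. -/
structure IsExtensionClosed (C : ∀ (G : Type u) [Group G], Prop) : Prop where
  of_mulEquiv : ∀ {G H : Type u} [Group G] [Group H], G ≃* H → C G → C H
  subgroup : ∀ {G : Type u} [Group G] (S : Subgroup G), C G → C S
  extension : ∀ {G : Type u} [Group G] (N : Subgroup G) [N.Normal], C N → C (G ⧸ N) → C G
  of_commGroup : ∀ (G : Type u) [CommGroup G], C G

theorem isExtensionClosed_isAmenable : IsExtensionClosed.{u} IsAmenable where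
  of_mulEquiv := IsAmenable.of_mulEquiv
  subgroup := IsAmenable.subgroup
  extension := IsAmenable.extension
  of_commGroup := isAmenable_of_commGroup

theorem isExtensionClosed_isElementaryAmenable :
    IsExtensionClosed.{u} IsElementaryAmenable where
  of_mulEquiv := .of_mulEquiv
  subgroup := .subgroup
  extension := .extension
  of_commGroup G _ := .of_isSolvable G

namespace IsExtensionClosed

variable {C : ∀ (G : Type u) [Group G], Prop} (hC : IsExtensionClosed C)
include hC

theorem of_injective {G H : Type u} [Group G] [Group H] (φ : G →* H)
    (hφ : Function.Injective φ) (hH : C H) : C G :=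
  hC.of_mulEquiv (MonoidHom.ofInjective hφ).symm (hC.subgroup φ.range hH)

theorem of_ker {G H : Type u} [Group G] [Group H] (φ : G →* H) (hK : C φ.ker) (hH : C H) : C G :=
  hC.extension φ.ker hK (hC.of_injective (QuotientGroup.kerLift φ)
    (QuotientGroup.kerLift_injective φ) hH)

theorem prod {G H : Type u} [Group G] [Group H] (hG : C G) (hH : C H) : C (G × H) := by
  refine hC.of_ker (MonoidHom.fst G H) (hC.of_injective
    ((MonoidHom.snd G H).comp (MonoidHom.fst G H).ker.subtype) ?_ hH) hG
  rintro ⟨⟨a, b⟩, hab⟩ ⟨⟨c, d⟩, hcd⟩ h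
  obtain rfl : a = 1 := hab
  obtain rfl : c = 1 := hcd
  obtain rfl : b = d := h
  rfl

theorem quotient_inf_ker {F H : Type u} [Group F] [Group H] (N : Subgroup F) [N.Normal]
    (hN : C (F ⧸ N)) (D : F →* H) (hH : C H) : C (F ⧸ (N ⊓ D.ker)) := by
  let φ : F →* (F ⧸ N) × H := (QuotientGroup.mk' N).prod D
  have hk : φ.ker = N ⊓ D.ker := by
    ext x
    simp [φ, MonoidHom.mem_ker, Prod.ext_iff]
  refine hC.of_mulEquiv (QuotientGroup.quotientMulEquivOfEq hk) ?_
  exact hC.of_injective (QuotientGroup.kerLift φ) (QuotientGroup.kerLift_injective φ)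
    (hC.prod hN hH)

/-- An extension of `F ⧸ N` by the abelianization of `N`. -/
theorem quotient_commutator {F : Type u} [Group F] (N : Subgroup F) [N.Normal]
    (hN : C (F ⧸ N)) : C (F ⧸ ⁅N, N⁆) := by
  let φ : F ⧸ ⁅N, N⁆ →* F ⧸ N :=
    QuotientGroup.map _ _ (MonoidHom.id F) (Subgroup.commutator_le_self N)
  refine hC.of_ker φ ?_ hN
  have mem (a : F) (h : (a : F ⧸ ⁅N, N⁆) ∈ φ.ker) : a ∈ N :=
    (QuotientGroup.eq_one_iff a).1 h
  have comm (a b : φ.ker) : a * b = b * a := by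
    obtain ⟨a, ha⟩ := a
    obtain ⟨b, hb⟩ := b
    induction a using QuotientGroup.induction_on with | H a =>
    induction b using QuotientGroup.induction_on with | H b =>
    refine Subtype.ext (commutatorElement_eq_one_iff_mul_comm.1 ?_)
    exact (QuotientGroup.eq_one_iff _).2
      (Subgroup.commutator_mem_commutator (mem a ha) (mem b hb))
  exact @of_commGroup _ hC φ.ker { (inferInstance : Group φ.ker) with mul_comm := comm }

end IsExtensionClosed

/-! ### Actions of the free product detecting reduced words. -/

section FreeProduct

open Monoid

variable {ι : Type u} {G : ι → Type u} [∀ i, Group (G i)]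

/-- The product of a list of letters in the free product. -/
def letterProd (l : List (Σ i, G i)) : CoprodI G := (l.map fun p ↦ CoprodI.of p.2).prod

theorem letterProd_append_singleton (l : List (Σ i, G i)) (p : Σ i, G i) :
    letterProd (l ++ [p]) = letterProd l * CoprodI.of p.2 := by
  simp [letterProd]

/-- The endomorphism of `M × (H → ℤ)` by which a single letter acts in `twistedExtension`. -/
def twistedEnd {M H : Type u} [AddCommGroup M] [Group H] (r : AddMonoid.End M) (d : H)
    (v : M) : AddMonoid.End (M × (H → ℤ)) :=
  AddMonoidHom.mk' (fun p ↦ (r p.1 + (p.2 d - p.2 1) • v, fun y ↦ p.2 (y * d))) fun p q ↦ by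
    refine Prod.ext ?_ rfl
    simp only [Prod.fst_add, Prod.snd_add, Pi.add_apply, map_add, add_sub_add_comm, add_smul]
    abel

theorem twistedEnd_apply {M H : Type u} [AddCommGroup M] [Group H] (r : AddMonoid.End M) (d : H)
    (v : M) (p : M × (H → ℤ)) :
    twistedEnd r d v p = (r p.1 + (p.2 d - p.2 1) • v, fun y ↦ p.2 (y * d)) := rfl

/-- Extension of the action `ρ` on `M` by the right regular action of `H` on `H → ℤ` through `D`,
twisted on each factor by a cocycle with values in `ℤ v`. -/
def twistedExtension {M H : Type u} [AddCommGroup M] [Group H] (ρ : CoprodI G →* AddMonoid.End M)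
    (D : CoprodI G →* H) (v : M)
    (hv : ∀ i, (∀ x : G i, ρ (CoprodI.of x) v = v) ∨ ∀ x : G i, D (CoprodI.of x) = 1) :
    CoprodI G →* AddMonoid.End (M × (H → ℤ)) :=
  CoprodI.lift fun i ↦
    { toFun := fun x ↦ twistedEnd (ρ (CoprodI.of x)) (D (CoprodI.of x)) v
      map_one' := by
        refine DFunLike.ext (F := AddMonoid.End (M × (H → ℤ))) _ _ fun p ↦ ?_
        simp [twistedEnd_apply]
      map_mul' := fun x y ↦ by
        refine DFunLike.ext (F := AddMonoid.End (M × (H → ℤ))) _ _ fun p ↦ ?_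
        simp only [twistedEnd_apply, map_mul, AddMonoid.End.coe_mul, Function.comp_apply, one_mul]
        refine Prod.ext ?_ (funext fun z ↦ congrArg p.2 (mul_assoc _ _ _).symm)
        -- The cocycle identity on one factor: either `v` is fixed, or the coefficients of `v` all
        -- vanish.
        rcases hv i with h | h
        · simp only [map_add, map_zsmul, h, sub_smul, map_sub]
          abel
        · simp [h] }

variable {M H : Type u} [AddCommGroup M] [Group H] {ρ : CoprodI G →* AddMonoid.End M}
  {D : CoprodI G →* H} {v : M}
  {hv : ∀ i, (∀ x : G i, ρ (CoprodI.of x) v = v) ∨ ∀ x : G i, D (CoprodI.of x) = 1}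

theorem twistedExtension_of {i : ι} (x : G i) (m : M) (f : H → ℤ) :
    twistedExtension ρ D v hv (CoprodI.of x) (m, f) =
      (ρ (CoprodI.of x) m + (f (D (CoprodI.of x)) - f 1) • v,
        fun y ↦ f (y * D (CoprodI.of x))) := by
  rw [twistedExtension, CoprodI.lift_of]
  rfl

theorem twistedExtension_inl (g : CoprodI G) (m : M) :
    twistedExtension ρ D v hv g (m, 0) = (ρ g m, 0) := by
  induction g using CoprodI.induction_on generalizing m with
  | one => simp
  | of i x => rw [twistedExtension_of]; ext <;> simp
  | mul a b ha hb => rw [map_mul, map_mul, AddMonoid.End.coe_mul, Function.comp_apply, hb, ha]; rfl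

theorem twistedExtension_snd (g : CoprodI G) (p : M × (H → ℤ)) :
    (twistedExtension ρ D v hv g p).2 = fun y ↦ p.2 (y * D g) := by
  induction g using CoprodI.induction_on generalizing p with
  | one => simp
  | of i x => obtain ⟨m, f⟩ := p; rw [twistedExtension_of]
  | mul a b ha hb => rw [map_mul, map_mul, AddMonoid.End.coe_mul, Function.comp_apply, ha, hb]; simp [mul_assoc]

theorem twistedExtension_eq_add (g : CoprodI G) (m : M) (f : H → ℤ) :
    twistedExtension ρ D v hv g (m, f) =
      (ρ g m, 0) + twistedExtension ρ D v hv g (0, f) := by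
  rw [← twistedExtension_inl (hv := hv), ← map_add]
  simp

/-- Elements of `N ⊓ D.ker` act by shears `(m, f) ↦ (m + c f, f)`, and these commute. -/
theorem twistedExtension_eq_one_of_mem_commutator (N : Subgroup (CoprodI G))
    (hN : ∀ g ∈ N, ρ g = 1) {g : CoprodI G} (hg : g ∈ ⁅N ⊓ D.ker, N ⊓ D.ker⁆) :
    twistedExtension ρ D v hv g = 1 := by
  have act (a : CoprodI G) (ha : a ∈ N ⊓ D.ker) (m : M) (f : H → ℤ) :
      twistedExtension ρ D v hv a (m, f) =
        (m + (twistedExtension ρ D v hv a (0, f)).1, f) := by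
    rw [twistedExtension_eq_add, hN a ha.1]
    refine Prod.ext rfl ?_
    rw [Prod.snd_add, twistedExtension_snd, MonoidHom.mem_ker.1 ha.2]
    simp
  suffices h : ⁅N ⊓ D.ker, N ⊓ D.ker⁆ ≤ (twistedExtension ρ D v hv).ker from h hg
  rw [Subgroup.commutator_le]
  intro a ha b hb
  have comm : twistedExtension ρ D v hv (a * b) = twistedExtension ρ D v hv (b * a) := by
    refine DFunLike.ext (F := AddMonoid.End (M × (H → ℤ))) _ _ fun p ↦ ?_
    obtain ⟨m, f⟩ := p
    rw [map_mul, map_mul, AddMonoid.End.coe_mul, AddMonoid.End.coe_mul,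
      Function.comp_apply, Function.comp_apply,
      act b hb m, act a ha m,
      act a ha (m + _), act b hb (m + _), add_right_comm]
  rw [MonoidHom.mem_ker, commutatorElement_def, mul_assoc, map_mul, comm, ← map_mul]
  simp [mul_assoc]

/-- Each letter contributes to the first coordinate a multiple of `v` moved by the letters to its
left, a word of length less than `n`. -/
theorem twistedExtension_letterProd_eq_zero (n : ℕ) (e : M →+ ℤ)
    (he : ∀ u : List (Σ i, G i), u.length < n → e (ρ (letterProd u) v) = 0)
    (u : List (Σ i, G i)) (hu : u.length ≤ n) (f : H → ℤ) :
    e (twistedExtension ρ D v hv (letterProd u) (0, f)).1 = 0 := by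
  induction u using List.reverseRecOn generalizing f with
  | nil => simp [letterProd]
  | append_singleton u p ih =>
    rw [List.length_append, List.length_singleton] at hu
    rw [letterProd_append_singleton, map_mul, AddMonoid.End.coe_mul, Function.comp_apply, twistedExtension_of,
      twistedExtension_eq_add, Prod.fst_add, map_add, ih (by omega)]
    simp [he u (by omega)]

/-- The homomorphism from the free product that is `ψ` on one factor and trivial on the others. -/
theorem exists_hom_of_factor {i : ι} (ψ : G i →* H) : ∃ D : CoprodI G →* H,
    (∀ x : G i, D (CoprodI.of x) = ψ x) ∧ ∀ j ≠ i, ∀ x : G j, D (CoprodI.of x) = 1 := by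
  classical
  refine ⟨CoprodI.lift fun j ↦ if h : j = i then ψ.comp (h ▸ MonoidHom.id (G j)) else 1,
    fun x ↦ ?_, fun j hj x ↦ ?_⟩
  · rw [CoprodI.lift_of]; simp
  · rw [CoprodI.lift_of]; simp [hj]

theorem exists_action_detecting_word {C : ∀ (G : Type u) [Group G], Prop}
    (hC : IsExtensionClosed C) (hG : ∀ i, IsResidually C (G i)) (l : List (Σ i, G i))
    (hl : ∀ p ∈ l, p.2 ≠ 1) (hchain : l.IsChain fun p q ↦ p.1 ≠ q.1) :
    ∃ (M : Type u) (_ : AddCommGroup M) (ρ : CoprodI G →* AddMonoid.End M) (v : M) (e : M →+ ℤ)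
      (N : Subgroup (CoprodI G)) (_ : N.Normal),
      C (CoprodI G ⧸ N) ∧ (∀ g ∈ N, ρ g = 1) ∧
      (∀ j, (∀ p ∈ l.getLast?, p.1 ≠ j) → ∀ x : G j, ρ (CoprodI.of x) v = v) ∧
      (∀ u : List (Σ i, G i), u.length < l.length → e (ρ (letterProd u) v) = 0) ∧
      e (ρ (letterProd l) v) = 1 := by
  induction l using List.reverseRecOn with
  | nil =>
    refine ⟨PUnit → ℤ, inferInstance, 1, 1, Pi.evalAddMonoidHom _ PUnit.unit, ⊤, inferInstance,
      ?_, fun _ _ ↦ rfl, fun _ _ _ ↦ rfl, by simp, rfl⟩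
    have := QuotientGroup.subsingleton_quotient_top (G := CoprodI G)
    exact hC.of_injective (1 : _ →* PUnit.{u + 1}) (Function.injective_of_subsingleton _)
      (hC.of_commGroup PUnit)
  | append_singleton l p ih =>
    rw [List.isChain_append] at hchain
    obtain ⟨M, _, ρ, v, e, N, _, hN, hNρ, hv, he, hle⟩ :=
      ih (fun q hq ↦ hl q (by simp [hq])) hchain.1
    obtain ⟨i, x⟩ := p
    obtain ⟨H, _, ψ, hH, -, hψ⟩ := hG i x (hl ⟨i, x⟩ (by simp))
    obtain ⟨D, hDi, hDj⟩ := exists_hom_of_factor ψ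
    have hvi (j : ι) : (∀ x : G j, ρ (CoprodI.of x) v = v) ∨
        ∀ x : G j, D (CoprodI.of x) = 1 := by
      by_cases hj : j = i
      · subst hj
        -- The word is reduced, so the previous letter lies in another factor and `v` is fixed by
        -- this one.
        exact .inl (hv j fun p hp ↦ hchain.2.2 p hp ⟨j, x⟩ rfl)
      · exact .inr (hDj j hj)
    classical
    have vanish := fun u hu f ↦ twistedExtension_letterProd_eq_zero (hv := hvi) l.length e he u hu f
    -- Since `ψ x ≠ 1`, the delta function at `ψ x` makes the letter `x` produce exactly one copy of
    -- the old `v`.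
    refine ⟨M × (H → ℤ), inferInstance, twistedExtension ρ D v hvi, (0, Pi.single (ψ x) 1),
      e.comp (AddMonoidHom.fst _ _), ⁅N ⊓ D.ker, N ⊓ D.ker⁆, inferInstance,
      hC.quotient_commutator _ (hC.quotient_inf_ker N hN D hH),
      fun g hg ↦ twistedExtension_eq_one_of_mem_commutator N hNρ hg, fun j hj y ↦ ?_,
      fun u hu ↦ ?_, ?_⟩
    · have hji : j ≠ i := fun h ↦ hj ⟨i, x⟩ (by simp) h.symm
      rw [twistedExtension_of, hDj j hji]
      simp
    · exact vanish u (by simpa [Nat.lt_succ_iff] using hu) _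
    · rw [letterProd_append_singleton, map_mul, AddMonoid.End.coe_mul, Function.comp_apply, twistedExtension_of,
        twistedExtension_eq_add, map_add]
      rw [AddMonoidHom.comp_apply, AddMonoidHom.comp_apply, AddMonoidHom.coe_fst,
        vanish l le_rfl, hDi]
      simp [Ne.symm hψ, hle]

theorem isResidually_coprodI {C : ∀ (G : Type u) [Group G], Prop} (hC : IsExtensionClosed C)
    (hG : ∀ i, IsResidually C (G i)) : IsResidually C (CoprodI G) := by
  classical
  intro g hg
  let w := CoprodI.Word.equiv g
  have hw : letterProd w.toList = g := CoprodI.Word.equiv.symm_apply_apply g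
  have hne : w.toList ≠ [] := by
    intro h
    rw [h] at hw
    exact hg hw.symm
  obtain ⟨M, _, ρ, v, e, N, _, hN, hNρ, -, he, hle⟩ :=
    exists_action_detecting_word hC hG w.toList (fun p hp ↦ w.ne_one p hp) w.chain_ne
  refine ⟨_, inferInstance, QuotientGroup.mk' N, hN, QuotientGroup.mk'_surjective N, fun h ↦ ?_⟩
  have h0 : e v = 0 := by
    simpa [letterProd] using he [] (List.length_pos_iff.2 hne)
  rw [hw, hNρ g ((QuotientGroup.eq_one_iff g).1 h), AddMonoid.End.coe_one, id, h0] at hle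
  exact zero_ne_one hle

end FreeProduct

theorem corollary2 {ι : Type u} (G : ι → Type u) [∀ i, Group (G i)] :
    ((∀ i, IsResidually IsAmenable (G i)) →
      IsResidually IsAmenable (Monoid.CoprodI G)) ∧
    ((∀ i, IsResidually IsElementaryAmenable (G i)) →
      IsResidually IsElementaryAmenable (Monoid.CoprodI G)) :=
  ⟨isResidually_coprodI isExtensionClosed_isAmenable,
    isResidually_coprodI isExtensionClosed_isElementaryAmenable⟩
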